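/- All graphs are finite and simple. For a graph $X$ with adjacency matrix $A$ and diagonal degree matrix $D$, put $\psi(X,t,\mu)=\det\bigl(tI-(A-\mu D)\bigr)$, a polynomial in the indeterminates $t,\mu$. Graphs $X_1,X_2$ with adjacency matrices $A_1,A_2$ and degree matrices $D_1,D_2$ are degree similar if there is an invertible real matrix $M$ with $M^{-1}A_1M=A_2$ and $M^{-1}D_1M=D_2$. Let $T_1$ and $T_2$ be the following trees on the vertex set $\{0,1,\dots,15\}$, both rooted at the vertex $0$. The edges of $T_1$ are $$01,\ 12,\ 23,\ 14,\ 45,\ 06,\ 67,\ 78,\ 89,\ \{9,10\},\ \{7,11\},\ \{11,12\},\ \{12,13\},\ \{13,14\},\ \{13,15\},$$ and the edges of $T_2$ are $$01,\ 12,\ 23,\ 24,\ 05,\ 56,\ 67,\ 78,\ 59,\ \{9,10\},\ \{10,11\},\ \{11,12\},\ \{12,13\},\ \{11,14\},\ \{14,15\}$$ (where $ij$ denotes the edge $\{i,j\}$). For a graph $S$ and a vertex $r$ of $S$, let $S\bullet T_i$ be the graph obtained from the disjoint union of $S$ and $T_i$ by identifying the root of $T_i$ with $r$; the same vertex $r$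 is used for $i=1,2$. Then for every tree $S$ with at least two vertices and every vertex $r$ of $S$, $$\psi(S\bullet T_1,t,\mu)=\psi(S\bullet T_2,t,\mu),$$ but $S\bullet T_1$ and $S\bullet T_2$ are not degree similar. -/

import Mathlib

open Matrix Polynomial

/-- The generalized characteristic polynomial `ψ(X, t, μ) = det (t I - (A - μ D))` of a finite
graph `X`, where `A` is the adjacency matrix and `D` the diagonal matrix of vertex degrees.
It is an element of `ℤ[μ][t]`: the outer variable `X` is `t`, and `C X` is `μ`. -/
noncomputable def psi {V : Type*} [Fintype V] [DecidableEq V] (G : SimpleGraph V)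
    [DecidableRel G.Adj] : ℤ[X][X] :=
  ((X : ℤ[X][X]) • (1 : Matrix V V ℤ[X][X]) -
    (G.adjMatrix ℤ[X][X] - (C X : ℤ[X][X]) • G.degMatrix ℤ[X][X])).det

/-- Two finite graphs are degree similar if there is an invertible real matrix `M`
(with inverse `N`) such that `M⁻¹ A₁ M = A₂` and `M⁻¹ D₁ M = D₂`. -/
def DegreeSimilar {V W : Type*} [Fintype V] [DecidableEq V] [Fintype W] [DecidableEq W]
    (G : SimpleGraph V) [DecidableRel G.Adj] (H : SimpleGraph W) [DecidableRel H.Adj] : Prop :=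
  ∃ (M : Matrix V W ℝ) (N : Matrix W V ℝ), M * N = 1 ∧ N * M = 1 ∧
    N * G.adjMatrix ℝ * M = H.adjMatrix ℝ ∧ N * G.degMatrix ℝ * M = H.degMatrix ℝ

/-- The adjacency relation of the coalescence: the vertex `r` of `S` doubles as the root of
`T`, and the other vertices of `T` are added to those of `S`. -/
def coalescenceAdj {V W : Type*} (S : SimpleGraph V) (r : V) (T : SimpleGraph W) (root : W) :
    V ⊕ {w : W // w ≠ root} → V ⊕ {w : W // w ≠ root} → Prop
  | Sum.inl x, Sum.inl y => S.Adj x y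
  | Sum.inl x, Sum.inr y => x = r ∧ T.Adj root y
  | Sum.inr x, Sum.inl y => y = r ∧ T.Adj x root
  | Sum.inr x, Sum.inr y => T.Adj x y

/-- The coalescence `S • T`: the graph obtained from the disjoint union of `S` and `T` by
identifying the vertex `root` of `T` with the vertex `r` of `S`. -/
def coalescence {V W : Type*} (S : SimpleGraph V) (r : V) (T : SimpleGraph W) (root : W) :
    SimpleGraph (V ⊕ {w : W // w ≠ root}) where
  Adj := coalescenceAdj S r T root
  symm := ⟨by
    rintro (x | x) (y | y) h
    · exact S.adj_symm h
    · exact ⟨h.1, T.adj_symm h.2⟩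
    · exact ⟨h.1, T.adj_symm h.2⟩
    · exact T.adj_symm h⟩
  loopless := ⟨by
    rintro (x | x) h
    · exact S.irrefl h
    · exact T.irrefl h⟩

instance coalescence.decidableAdj {V W : Type*} [DecidableEq V] (S : SimpleGraph V)
    [DecidableRel S.Adj] (r : V) (T : SimpleGraph W) [DecidableRel T.Adj] (root : W) :
    DecidableRel (coalescence S r T root).Adj
  | Sum.inl x, Sum.inl y => inferInstanceAs (Decidable (S.Adj x y))
  | Sum.inl x, Sum.inr y => inferInstanceAs (Decidable (x = r ∧ T.Adj root y))
  | Sum.inr x, Sum.inl y => inferInstanceAs (Decidable (y = r ∧ T.Adj x root))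
  | Sum.inr x, Sum.inr y => inferInstanceAs (Decidable (T.Adj x y))

/-- The graph on `{0, …, 15}` with the listed edges. -/
def graphOfEdges (l : List (Fin 16 × Fin 16)) : SimpleGraph (Fin 16) :=
  SimpleGraph.fromRel fun a b => (a, b) ∈ l

instance graphOfEdges.decidableAdj (l : List (Fin 16 × Fin 16)) :
    DecidableRel (graphOfEdges l).Adj :=
  fun a b => inferInstanceAs (Decidable (a ≠ b ∧ ((a, b) ∈ l ∨ (b, a) ∈ l)))

/-- The tree `T₁` on 16 vertices; its root is the vertex `0`. -/
abbrev treeOne : SimpleGraph (Fin 16) :=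
  graphOfEdges [(0, 1), (1, 2), (2, 3), (1, 4), (4, 5), (0, 6), (6, 7), (7, 8), (8, 9), (9, 10),
    (7, 11), (11, 12), (12, 13), (13, 14), (13, 15)]

/-- The tree `T₂` on 16 vertices; its root is the vertex `0`. -/
abbrev treeTwo : SimpleGraph (Fin 16) :=
  graphOfEdges [(0, 1), (1, 2), (2, 3), (2, 4), (0, 5), (5, 6), (6, 7), (7, 8), (5, 9), (9, 10),
    (10, 11), (11, 12), (12, 13), (11, 14), (14, 15)]

/-!
The generalized characteristic polynomial of a coalescence `S • T` is computed by Gaussian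
elimination along `T`, from the leaves towards the root, over the fraction field of `ℤ[μ][t]`
(`det_genCharMatrix_coalescence`). The tree `T` enters the result only through the product of the
pivots at the vertices other than the root and through one number which is added to the diagonal entry
of `S` at `r`. Both quantities agree for `treeOne` and `treeTwo`
(`det_genCharMatrix_coalescence_treeOne_eq_treeTwo`). This part holds for every graph `S`.

A matrix that realizes a degree similarity intertwines the degree matrices, hence also the
projections onto the vertices of each fixed degree. Therefore degree similar graphs have the same
number of closed walks with any prescribed cyclic sequence of degrees
(`DegreeSimilar.trace_walkMatrix_eq`). Let `d` be the degree of `r` in the coalescence; it is at least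
`3`, as `r` has degree `2` in both trees and is not isolated in `S`. A closed walk with degrees
`d, 3, 2, 2, 1, 2, 2, 3` detects a vertex of degree `d` adjacent to a vertex of degree `3` that carries
a pendant path with three vertices. Since `d ≥ 3`, such a pendant path lies entirely in `S` or
entirely in `T`, and the count splits accordingly (`trace_walkMatrix_coalescence`). It is larger by
exactly one for `treeTwo`: there the root is adjacent to the vertex of degree `3` with the pendant
path, while in `treeOne` that vertex is at distance two from the root.
-/

/-! ### The generalized characteristic polynomial of a coalescence -/

theorem degree_coalescence_inl {V W : Type*} [Fintype V] [DecidableEq V] [Fintype W]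
    [DecidableEq W] (S : SimpleGraph V) [DecidableRel S.Adj] (r : V) (T : SimpleGraph W)
    [DecidableRel T.Adj] (root : W) (v : V) :
    (coalescence S r T root).degree (Sum.inl v) =
      S.degree v + if v = r then T.degree root else 0 := by
  have h1 := (coalescence S r T root).degree_eq_sum_if_adj (R := ℕ) (Sum.inl v)
  have h2 := S.degree_eq_sum_if_adj (R := ℕ) v
  have h3 := T.degree_eq_sum_if_adj (R := ℕ) root
  simp only [Nat.cast_id] at h1 h2 h3
  rw [Fintype.sum_eq_add_sum_subtype_ne _ root, if_neg (T.irrefl), zero_add] at h3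
  rw [h1, Fintype.sum_sum_type, h2, h3]
  congr 1
  split_ifs with hv
  · exact Finset.sum_congr rfl fun w _ => if_congr (by
      change (v = r ∧ T.Adj root w) ↔ _
      simp [hv]) rfl rfl
  · exact Finset.sum_eq_zero fun w _ => if_neg fun h => hv h.1

theorem degree_coalescence_inr {V W : Type*} [Fintype V] [DecidableEq V] [Fintype W]
    [DecidableEq W] (S : SimpleGraph V) [DecidableRel S.Adj] (r : V) (T : SimpleGraph W)
    [DecidableRel T.Adj] (root : W) (w : {w : W // w ≠ root}) :
    (coalescence S r T root).degree (Sum.inr w) = T.degree w := by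
  have h1 := (coalescence S r T root).degree_eq_sum_if_adj (R := ℕ) (Sum.inr w)
  have h3 := T.degree_eq_sum_if_adj (R := ℕ) w
  simp only [Nat.cast_id] at h1 h3
  rw [Fintype.sum_eq_add_sum_subtype_ne _ root] at h3
  rw [h1, Fintype.sum_sum_type, h3]
  congr 1
  rw [Finset.sum_eq_single r]
  · exact if_congr (by change (r = r ∧ T.Adj w root) ↔ _; simp) rfl rfl
  · exact fun v _ hv => if_neg fun h => hv h.1
  · simp

/-- The matrix `t I - (A - μ D)` of a graph, at elements `t` and `μ` of a ring. -/
def genCharMatrix {V R : Type*} [Fintype V] [DecidableEq V] [CommRing R] (G : SimpleGraph V)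
    [DecidableRel G.Adj] (t μ : R) : Matrix V V R :=
  t • (1 : Matrix V V R) - (G.adjMatrix R - μ • G.degMatrix R)

/-- The generalized characteristic polynomial specializes along ring homomorphisms. -/
theorem map_psi {V R : Type*} [Fintype V] [DecidableEq V] [CommRing R] (G : SimpleGraph V)
    [DecidableRel G.Adj] (φ : ℤ[X][X] →+* R) :
    φ (psi G) = (genCharMatrix G (φ X) (φ (C X))).det := by
  rw [psi, RingHom.map_det]
  congr 1
  ext i j
  by_cases h : i = j <;>
    simp [genCharMatrix, SimpleGraph.degMatrix, h, SimpleGraph.adjMatrix_apply, apply_ite φ]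

theorem genCharMatrix_apply {V R : Type*} [Fintype V] [DecidableEq V] [CommRing R]
    (G : SimpleGraph V) [DecidableRel G.Adj] (t μ : R) (i j : V) :
    genCharMatrix G t μ i j =
      (if i = j then t + μ * G.degree i else 0) - if G.Adj i j then 1 else 0 := by
  rcases eq_or_ne i j with rfl | h
  · simp [genCharMatrix, SimpleGraph.degMatrix]
  · simp [genCharMatrix, SimpleGraph.degMatrix, h]

/-- Gaussian elimination along a rooted tree `T` with parent function `p`, attached to `S` at `r`.
Eliminating the vertices of `T` from the leaves towards the root leaves at each vertex `w` the pivot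
`δ w`, which is its diagonal entry minus the sum of the inverse pivots of its children. What remains
is the matrix of `S` with the corresponding correction added to its entry at `r`, so that `T` enters
the determinant only through this correction and the product of the pivots. The values of `p` and
`δ` at the root are irrelevant. -/
theorem det_genCharMatrix_coalescence {V W K : Type*} [Fintype V] [DecidableEq V] [Fintype W]
    [LinearOrder W] [Field K] (S : SimpleGraph V) [DecidableRel S.Adj] (r : V)
    (T : SimpleGraph W) [DecidableRel T.Adj] (root : W) (t μ : K) (p : W → W) (δ : W → K)
    (hp : ∀ w, w ≠ root → p w < w)
    (hadj : ∀ u w, T.Adj u w ↔ (w ≠ root ∧ p w = u) ∨ (u ≠ root ∧ p u = w))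
    (hδ0 : ∀ w, w ≠ root → δ w ≠ 0)
    (hδ : ∀ w, w ≠ root → δ w = t + μ * T.degree w -
      ∑ u : {u : W // u ≠ root}, if p u = w then (δ u)⁻¹ else 0) :
    (genCharMatrix (coalescence S r T root) t μ).det =
      (genCharMatrix S t μ + single r r (μ * T.degree root -
        ∑ u : {u : W // u ≠ root}, if p u = root then (δ u)⁻¹ else 0)).det *
      ∏ w : {w : W // w ≠ root}, δ w := by
  set c := (μ * T.degree root -
        ∑ u : {u : W // u ≠ root}, if p u = root then (δ u)⁻¹ else 0) with hc
  -- `1 - P` is the unitriangular elimination matrix inside `T`, and `Q` eliminates the edges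
  -- between the root and its children; parents precede their children in the order.
  let P : Matrix {w : W // w ≠ root} {w : W // w ≠ root} K :=
    of fun u w => if p w = u then (δ w)⁻¹ else 0
  let Q : Matrix V {w : W // w ≠ root} K :=
    of fun v w => if v = r ∧ p w = root then -(δ w)⁻¹ else 0
  let Δ : Matrix {w : W // w ≠ root} {w : W // w ≠ root} K := diagonal fun w => δ w
  have hU : (1 - P).det = 1 := by
    rw [det_of_isUpperTriangular]
    · refine Finset.prod_eq_one fun w _ => ?_
      simp [P, (hp w w.2).ne]
    · intro u w h
      have h1 : w < u := h
      have h2 : p w ≠ u := fun h' => absurd (hp w w.2) (by rw [h']; exact not_lt.2 (le_of_lt h1))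
      simp [P, h2, h1.ne']
  have hPΔ : P * Δ = of fun u w : {w : W // w ≠ root} => if p w = u then (1 : K) else 0 := by
    ext u w
    simp [P, Δ, hδ0 w w.2]
  have hQΔ : Q * Δ = of fun v (w : {w : W // w ≠ root}) =>
      if v = r ∧ p w = root then (-1 : K) else 0 := by
    ext u w
    simp [Q, Δ, hδ0 w w.2]
  have hfac : genCharMatrix (coalescence S r T root) t μ =
      fromBlocks 1 Q 0 (1 - P) * fromBlocks (genCharMatrix S t μ + single r r c) 0 0 Δ *
        (fromBlocks 1 Q 0 (1 - P))ᵀ := by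
    rw [fromBlocks_multiply, fromBlocks_transpose, fromBlocks_multiply]
    simp only [Matrix.one_mul, Matrix.zero_mul, Matrix.mul_zero, add_zero, zero_add,
      transpose_one, transpose_zero, Matrix.mul_one, sub_mul, hPΔ, hQΔ, transpose_sub]
    ext (i | i) (j | j)
    · have hs : ((of fun v (w : {w : W // w ≠ root}) =>
          if v = r ∧ p w = root then (-1 : K) else 0) * Qᵀ) i j =
          single r r (∑ u : {u : W // u ≠ root}, if p u = root then (δ u)⁻¹ else 0) i j := by
        simp only [mul_apply, of_apply, transpose_apply, Q, single_apply]
        split_ifs with h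
        · obtain ⟨rfl, rfl⟩ := h
          refine Finset.sum_congr rfl fun u _ => ?_
          by_cases hu : p u = root <;> simp [hu]
        · refine Finset.sum_eq_zero fun u _ => ?_
          by_cases h1 : i = r
          · have h2 : j ≠ r := fun h2 => h ⟨h1.symm, h2.symm⟩
            simp [h2]
          · simp [h1]
      rw [fromBlocks_apply₁₁, Matrix.add_apply, Matrix.add_apply, hs, genCharMatrix_apply,
        genCharMatrix_apply, degree_coalescence_inl, hc]
      change _ - (if S.Adj i j then (1 : K) else 0) = _
      by_cases hij : i = j
      · subst hij
        by_cases hi : i = r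
        · subst hi
          simp
          ring
        · simp [hi, Ne.symm hi]
      · have h2 : ¬(r = i ∧ r = j) := fun h => hij (h.1.symm.trans h.2)
        simp [hij, h2]
    · have hs : ((of fun v (w : {w : W // w ≠ root}) =>
          if v = r ∧ p w = root then (-1 : K) else 0) * Pᵀ) i j = 0 := by
        simp only [mul_apply, of_apply, transpose_apply, P]
        refine Finset.sum_eq_zero fun u _ => ?_
        by_cases h1 : p u = root
        · simp [h1, j.2.symm]
        · simp [h1]
      rw [fromBlocks_apply₁₂, Matrix.mul_sub, Matrix.mul_one, Matrix.sub_apply, hs, genCharMatrix_apply]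
      change _ - (if i = r ∧ T.Adj root j then (1 : K) else 0) = _
      have := hadj root j
      simp only [ne_eq, not_true_eq_false, false_and, or_false] at this
      by_cases h1 : i = r <;> by_cases h2 : p j = root <;> simp [this, h1, h2, j.2]
    · have hs : (((of fun u w : {w : W // w ≠ root} => if p w = u then (1 : K) else 0)) * Qᵀ) i j
          = 0 := by
        simp only [mul_apply, of_apply, transpose_apply, Q]
        refine Finset.sum_eq_zero fun u _ => ?_
        by_cases h1 : p u = root
        · simp [h1, i.2.symm]
        · simp [h1]
      have hs2 : (Δ * Qᵀ) i j = if j = r ∧ p i = root then (-1 : K) else 0 := by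
        have := congrFun (congrFun hQΔ j) i
        rw [of_apply] at this
        rw [← this]
        simp [Δ, mul_comm]
      rw [fromBlocks_apply₂₁, Matrix.sub_mul, Matrix.sub_apply, hs, hs2, genCharMatrix_apply]
      change _ - (if j = r ∧ T.Adj i root then (1 : K) else 0) = _
      have := hadj i root
      simp only [ne_eq, not_true_eq_false, false_and, false_or] at this
      by_cases h1 : j = r <;> by_cases h2 : p i = root <;> simp [this, h1, h2, i.2]
    · have hs : ((of fun u w : {w : W // w ≠ root} => if p w = u then (1 : K) else 0) * Pᵀ) i j =
          if i = j then ∑ u : {u : W // u ≠ root}, (if p u = i then (δ u)⁻¹ else 0) else 0 := by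
        simp only [mul_apply, of_apply, transpose_apply, P]
        split_ifs with h
        · subst h
          refine Finset.sum_congr rfl fun u _ => ?_
          by_cases h1 : p u = i <;> simp [h1]
        · refine Finset.sum_eq_zero fun u _ => ?_
          by_cases h1 : p u = i
          · have h2 : (i : W) ≠ j := fun h' => h (Subtype.ext h')
            simp [h1, h2]
          · simp [h1]
      have hs2 : (Δ * Pᵀ) i j = if p i = j then 1 else 0 := by
        have := congrFun (congrFun hPΔ j) i
        rw [of_apply] at this
        rw [← this]
        simp [Δ, mul_comm]
      rw [fromBlocks_apply₂₂, Matrix.mul_sub, Matrix.mul_sub, Matrix.mul_one, Matrix.mul_one]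
      simp only [Matrix.sub_apply]
      rw [hs, hs2, genCharMatrix_apply, degree_coalescence_inr]
      change _ - (if T.Adj i j then (1 : K) else 0) = _
      rcases eq_or_ne i j with rfl | hij
      · have h1 := (hp i i.2).ne
        simp [Δ, h1, hδ i i.2]
      · have h1 := hadj i j
        have h2 : p j = i → p i ≠ j := fun h h' => absurd (hp i i.2) (by
          rw [h', ← h]; exact not_lt.2 (hp j j.2).le)
        by_cases h3 : p j = i
        · simp [Δ, hij, h1, h3, h2 h3, j.2]
        · by_cases h4 : p i = j <;> simp [Δ, hij, h1, h3, h4, i.2]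
  rw [hfac, det_mul, det_mul, det_transpose, det_fromBlocks_zero₂₁, det_fromBlocks_zero₂₁, hU]
  simp [Δ]

/-! ### The two trees as rooted trees -/

/-- Parents of the vertices of `treeOne`, rooted at `0`. -/
def parentOne : Fin 16 → Fin 16 := ![0, 0, 1, 2, 1, 4, 0, 6, 7, 8, 9, 7, 11, 12, 13, 13]

/-- Parents of the vertices of `treeTwo`, rooted at `0`. -/
def parentTwo : Fin 16 → Fin 16 := ![0, 0, 1, 2, 2, 0, 5, 6, 7, 5, 9, 10, 11, 12, 11, 14]

theorem degree_treeOne : ∀ w, treeOne.degree w =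
    (![2, 3, 2, 1, 2, 1, 2, 3, 2, 2, 1, 2, 2, 3, 1, 1] : Fin 16 → ℕ) w := by decide

theorem degree_treeTwo : ∀ w, treeTwo.degree w =
    (![2, 2, 3, 1, 1, 3, 2, 2, 1, 2, 2, 3, 2, 1, 2, 1] : Fin 16 → ℕ) w := by decide

theorem treeOne_adj_iff : ∀ u w, treeOne.Adj u w ↔
    (w ≠ 0 ∧ parentOne w = u) ∨ (u ≠ 0 ∧ parentOne u = w) := by decide

theorem treeTwo_adj_iff : ∀ u w, treeTwo.Adj u w ↔
    (w ≠ 0 ∧ parentTwo w = u) ∨ (u ≠ 0 ∧ parentTwo u = w) := by decide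

theorem sum_subtype_ne_zero {K : Type*} [AddCommMonoid K] (f : Fin 16 → K) :
    ∑ u : {u : Fin 16 // u ≠ 0}, f u = ∑ i : Fin 15, f i.succ := by
  rw [← Finset.sum_subtype (Finset.univ.erase 0) (by simp), Fin.univ_succ]
  simp

theorem prod_subtype_ne_zero {K : Type*} [CommMonoid K] (f : Fin 16 → K) :
    ∏ u : {u : Fin 16 // u ≠ 0}, f u = ∏ i : Fin 15, f i.succ := by
  rw [← Finset.prod_subtype (Finset.univ.erase 0) (by simp), Fin.univ_succ]
  simp

/-! ### The pivots of the two trees -/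

/-- The pivots of both trees are quotients of the determinants of a few rooted subtrees: pendant paths
with one, two and three vertices (`a`, `p₂`, `p₃`), and larger subtrees, from whose determinants one
copy of the factor `a` or `p₂` coming from a pair of equal branches has been cancelled.
The root corrections and the products of the pivots agree for the two trees as soon as no denominator
vanishes. -/
theorem det_genCharMatrix_coalescence_treeOne_eq_treeTwo {V K : Type*} [Fintype V]
    [DecidableEq V] [Field K] (S : SimpleGraph V) [DecidableRel S.Adj] (r : V)
    {x y a p₂ p₃ s b s₃ m n b₂ b₃ : K}
    (ha : a = x + y) (hp₂ : p₂ = (x + 2 * y) * a - 1) (hp₃ : p₃ = (x + 2 * y) * p₂ - a)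
    (hs : s = (x + 3 * y) * a - 2) (hb : b = (x + 2 * y) * s - a)
    (hs₃ : s₃ = (x + 2 * y) * b - s)
    (hm : m = (x + 3 * y) * p₃ * s₃ - p₂ * s₃ - b * p₃)
    (hn : n = (x + 2 * y) * m - p₃ * s₃)
    (hb₂ : b₂ = (x + 2 * y) * b - p₂) (hb₃ : b₃ = (x + 2 * y) * b₂ - b)
    (ha0 : a ≠ 0) (hp₂0 : p₂ ≠ 0) (hp₃0 : p₃ ≠ 0) (hs0 : s ≠ 0) (hb0 : b ≠ 0) (hs₃0 : s₃ ≠ 0)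
    (hm0 : m ≠ 0) (hn0 : n ≠ 0) (hb₂0 : b₂ ≠ 0) (hb₃0 : b₃ ≠ 0) :
    (genCharMatrix (coalescence S r treeOne 0) x y).det =
      (genCharMatrix (coalescence S r treeTwo 0) x y).det := by
  -- The determinants of the subtree of `treeOne` at `12` and of that of `treeTwo` at `11` are
  -- `a * b` and `p₂ * b`; those of the subtrees at `6` and at `5` are `a * n` and `p₂ * n`.
  have hb' : b = (x + 3 * y) * p₂ - 2 * a := by rw [hb, hs, hp₂, ha]; ring
  have hn' : n = (x + 3 * y) * p₃ * b₃ - p₂ * b₃ - b₂ * p₃ := by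
    rw [hn, hm, hs₃, hb₃, hb₂, hb, hs, hp₃, hp₂, ha]; ring
  let δ₁ : Fin 16 → K := ![0, b / p₂, p₂ / a, a, p₂ / a, a, n / m, m / (p₃ * s₃), p₃ / p₂,
    p₂ / a, a, s₃ / b, b / s, s / a, a, a]
  let δ₂ : Fin 16 → K := ![0, b / s, s / a, a, a, n / (p₃ * b₃), p₃ / p₂, p₂ / a, a, b₃ / b₂,
    b₂ / b, b / p₂, p₂ / a, a, p₂ / a, a]
  rw [det_genCharMatrix_coalescence S r treeOne 0 x y parentOne δ₁ (by decide) treeOne_adj_iff,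
    det_genCharMatrix_coalescence S r treeTwo 0 x y parentTwo δ₂ (by decide) treeTwo_adj_iff]
  · rw [degree_treeOne, degree_treeTwo]
    rw [prod_subtype_ne_zero, prod_subtype_ne_zero]
    rw [sum_subtype_ne_zero (fun u => if parentOne u = 0 then (δ₁ u)⁻¹ else 0),
      sum_subtype_ne_zero (fun u => if parentTwo u = 0 then (δ₂ u)⁻¹ else 0)]
    congr 1
    · congr 3
      simp [Fin.sum_univ_succ, parentOne, parentTwo, δ₁, δ₂]
      field_simp
      rw [hn, hm, hs₃, hb₃, hb₂, hb, hs, hp₃, hp₂, ha]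
      ring
    · simp [Fin.prod_univ_succ, δ₁, δ₂]
      field_simp
  · intro w hw
    fin_cases w <;> simp [δ₂, ha0, hp₂0, hp₃0, hs0, hb0, hn0, hb₂0, hb₃0] at hw ⊢
  · intro w hw
    rw [degree_treeTwo, sum_subtype_ne_zero (fun u => if parentTwo u = w then (δ₂ u)⁻¹ else 0)]
    fin_cases w <;> simp [Fin.sum_univ_succ, parentTwo, δ₂] at hw ⊢
    all_goals try field_simp
    all_goals first
      | linear_combination ha
      | linear_combination hp₂
      | linear_combination hp₃
      | linear_combination hs
      | linear_combination hb
      | linear_combination hb'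
      | linear_combination hb₂
      | linear_combination hb₃
      | linear_combination hn'
  · intro w hw
    fin_cases w <;> simp [δ₁, ha0, hp₂0, hp₃0, hs0, hb0, hs₃0, hm0, hn0] at hw ⊢
  · intro w hw
    rw [degree_treeOne, sum_subtype_ne_zero (fun u => if parentOne u = w then (δ₁ u)⁻¹ else 0)]
    fin_cases w <;> simp [Fin.sum_univ_succ, parentOne, δ₁] at hw ⊢
    all_goals try field_simp
    all_goals first
      | linear_combination ha
      | linear_combination hp₂
      | linear_combination hp₃
      | linear_combination hs
      | linear_combination hb
      | linear_combination hb'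
      | linear_combination hs₃
      | linear_combination hm
      | linear_combination hn

/-- The generalized characteristic polynomials agree for every graph `S`, since the elimination can be
carried out in the fraction field of `ℤ[μ][t]`. -/
theorem psi_coalescence_treeOne_eq_treeTwo {V : Type*} [Fintype V] [DecidableEq V]
    (S : SimpleGraph V) [DecidableRel S.Adj] (r : V) :
    psi (coalescence S r treeOne 0) = psi (coalescence S r treeTwo 0) := by
  let φ : ℤ[X][X] →+* FractionRing ℤ[X][X] := algebraMap _ _
  have hφ : Function.Injective φ := IsFractionRing.injective _ _
  -- The denominators are nonzero because they do not vanish at `μ = 0`, `t = 100`.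
  let ev : ℤ[X][X] →+* ℤ := (evalRingHom 0).comp (evalRingHom (C 100))
  have evX : ev X = 100 := by simp [ev]
  have evC : ev (C X) = 0 := by simp [ev]
  have ev2 : ev 2 = 2 := map_ofNat ev 2
  have ev3 : ev 3 = 3 := map_ofNat ev 3
  have φ2 : φ 2 = 2 := map_ofNat φ 2
  have φ3 : φ 3 = 3 := map_ofNat φ 3
  have key : ∀ q, ev q ≠ 0 → φ q ≠ 0 := fun q hq h => hq (by
    rw [(map_eq_zero_iff φ hφ).1 h, map_zero])
  apply hφ
  rw [map_psi, map_psi]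
  obtain ⟨a, ha⟩ : ∃ a : ℤ[X][X], a = X + C X := ⟨_, rfl⟩
  obtain ⟨p₂, hp₂⟩ : ∃ a' : ℤ[X][X], a' = (X + 2 * C X) * a - 1 := ⟨_, rfl⟩
  obtain ⟨p₃, hp₃⟩ : ∃ a' : ℤ[X][X], a' = (X + 2 * C X) * p₂ - a := ⟨_, rfl⟩
  obtain ⟨s, hs⟩ : ∃ a' : ℤ[X][X], a' = (X + 3 * C X) * a - 2 := ⟨_, rfl⟩
  obtain ⟨b, hb⟩ : ∃ a' : ℤ[X][X], a' = (X + 2 * C X) * s - a := ⟨_, rfl⟩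
  obtain ⟨s₃, hs₃⟩ : ∃ a' : ℤ[X][X], a' = (X + 2 * C X) * b - s := ⟨_, rfl⟩
  obtain ⟨m, hm⟩ : ∃ a' : ℤ[X][X], a' = (X + 3 * C X) * p₃ * s₃ - p₂ * s₃ - b * p₃ := ⟨_, rfl⟩
  obtain ⟨n, hn⟩ : ∃ a' : ℤ[X][X], a' = (X + 2 * C X) * m - p₃ * s₃ := ⟨_, rfl⟩
  obtain ⟨b₂, hb₂⟩ : ∃ a' : ℤ[X][X], a' = (X + 2 * C X) * b - p₂ := ⟨_, rfl⟩
  obtain ⟨b₃, hb₃⟩ : ∃ a' : ℤ[X][X], a' = (X + 2 * C X) * b₂ - b := ⟨_, rfl⟩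
  have ea : ev a = 100 := by
    rw [ha]; norm_num [evX, evC, ev2, ev3]
  have ep₂ : ev p₂ = 9999 := by
    rw [hp₂]; norm_num [evX, evC, ev2, ev3, ea]
  have ep₃ : ev p₃ = 999800 := by
    rw [hp₃]; norm_num [evX, evC, ev2, ev3, ea, ep₂]
  have es : ev s = 9998 := by
    rw [hs]; norm_num [evX, evC, ev2, ev3, ea, ep₂, ep₃]
  have eb : ev b = 999700 := by
    rw [hb]; norm_num [evX, evC, ev2, ev3, ea, ep₂, ep₃, es]
  have es₃ : ev s₃ = 99960002 := by
    rw [hs₃]; norm_num [evX, evC, ev2, ev3, ea, ep₂, ep₃, es, eb]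
  have em : ev m = 9992001999840002 := by
    rw [hm]; norm_num [evX, evC, ev2, ev3, ea, ep₂, ep₃, es, eb, es₃]
  have en : ev n = 999100259974000600 := by
    rw [hn]; norm_num [evX, evC, ev2, ev3, ea, ep₂, ep₃, es, eb, es₃, em]
  have eb₂ : ev b₂ = 99960001 := by
    rw [hb₂]; norm_num [evX, evC, ev2, ev3, ea, ep₂, ep₃, es, eb, es₃, em, en]
  have eb₃ : ev b₃ = 9995000400 := by
    rw [hb₃]; norm_num [evX, evC, ev2, ev3, ea, ep₂, ep₃, es, eb, es₃, em, en, eb₂]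
  refine det_genCharMatrix_coalescence_treeOne_eq_treeTwo S r
    (a := φ a) (p₂ := φ p₂) (p₃ := φ p₃) (s := φ s) (b := φ b) (s₃ := φ s₃) (m := φ m)
    (n := φ n) (b₂ := φ b₂) (b₃ := φ b₃) ?_ ?_ ?_ ?_ ?_ ?_ ?_ ?_ ?_ ?_
    (key _ (by rw [ea]; norm_num))
    (key _ (by rw [ep₂]; norm_num))
    (key _ (by rw [ep₃]; norm_num))
    (key _ (by rw [es]; norm_num))
    (key _ (by rw [eb]; norm_num))
    (key _ (by rw [es₃]; norm_num))
    (key _ (by rw [em]; norm_num))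
    (key _ (by rw [en]; norm_num))
    (key _ (by rw [eb₂]; norm_num))
    (key _ (by rw [eb₃]; norm_num))
  · rw [ha]; simp
  · rw [hp₂]; simp [φ2]
  · rw [hp₃]; simp [φ2]
  · rw [hs]; simp [φ2, φ3]
  · rw [hb]; simp [φ2]
  · rw [hs₃]; simp [φ2]
  · rw [hm]; simp [φ3]
  · rw [hn]; simp [φ2]
  · rw [hb₂]; simp [φ2]
  · rw [hb₃]; simp [φ2]

/-! ### Closed walks with a prescribed sequence of degrees -/

/-- The orthogonal projection onto the coordinates of the vertices of degree `d`. -/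
def degProj {V : Type*} [Fintype V] [DecidableEq V] (G : SimpleGraph V) [DecidableRel G.Adj]
    (d : ℕ) : Matrix V V ℝ :=
  diagonal fun v => if G.degree v = d then 1 else 0

/-- The matrix `E_{d₀} A E_{d₁} A ⋯ E_{dₖ} A`, where `E_d` is the projection onto the vertices of
degree `d`: its entries count the walks visiting, before their last step, vertices of the degrees
`d₀, …, dₖ` in this order. -/
def walkMatrix {V : Type*} [Fintype V] [DecidableEq V] (G : SimpleGraph V) [DecidableRel G.Adj] :
    List ℕ → Matrix V V ℝ
  | [] => 1
  | d :: l => degProj G d * G.adjMatrix ℝ * walkMatrix G l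

/-- Any function of the degree matrix is respected by a matrix intertwining the degree matrices,
so that the numbers of closed walks with a prescribed sequence of degrees agree. -/
theorem DegreeSimilar.trace_walkMatrix_eq {V W : Type*} [Fintype V] [DecidableEq V] [Fintype W]
    [DecidableEq W] {G : SimpleGraph V} [DecidableRel G.Adj] {H : SimpleGraph W}
    [DecidableRel H.Adj] (h : DegreeSimilar G H) (l : List ℕ) :
    (walkMatrix G l).trace = (walkMatrix H l).trace := by
  obtain ⟨M, N, hMN, hNM, hA, hD⟩ := h
  have intertwine : ∀ {X : Matrix V V ℝ} {Y : Matrix W W ℝ}, N * X * M = Y → X * M = M * Y := by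
    rintro X Y rfl
    rw [← Matrix.mul_assoc, ← Matrix.mul_assoc, hMN, Matrix.one_mul]
  have hA' := intertwine hA
  have hE (d : ℕ) : degProj G d * M = M * degProj H d := by
    have hD' := intertwine hD
    ext v w
    have h1 := congrFun (congrFun hD' v) w
    simp only [SimpleGraph.degMatrix, diagonal_mul, mul_diagonal] at h1
    simp only [degProj, diagonal_mul, mul_diagonal]
    rcases eq_or_ne (M v w) 0 with h0 | h0
    · simp [h0]
    · have h2 : (G.degree v : ℝ) = H.degree w := mul_right_cancel₀ h0 (h1.trans (mul_comm _ _))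
      rw [Nat.cast_injective h2, mul_comm]
  have hW : walkMatrix G l * M = M * walkMatrix H l := by
    induction l with
    | nil => simp [walkMatrix]
    | cons d l ih =>
      rw [walkMatrix, walkMatrix, Matrix.mul_assoc, ih, ← Matrix.mul_assoc,
        Matrix.mul_assoc _ _ M, hA', ← Matrix.mul_assoc, hE]
      simp only [Matrix.mul_assoc]
  calc (walkMatrix G l).trace = (walkMatrix G l * M * N).trace := by
        rw [Matrix.mul_assoc, hMN, Matrix.mul_one]
    _ = (N * (M * walkMatrix H l)).trace := by rw [hW, trace_mul_comm]
    _ = _ := by rw [← Matrix.mul_assoc, hNM, Matrix.one_mul]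

/-- The row of the adjacency matrix of `T` at `root`, placed in the row `r`: the block of the
adjacency matrix of a coalescence that joins its two parts. -/
def rootBlock {V W : Type*} [DecidableEq V] (r : V) (T : SimpleGraph W) [DecidableRel T.Adj]
    (root : W) :
    Matrix V {w : W // w ≠ root} ℝ :=
  of fun v w => if v = r ∧ T.Adj root w then 1 else 0

/-- The adjacency matrix of `T` with the root deleted. -/
def branchAdj {W : Type*} (T : SimpleGraph W) [DecidableRel T.Adj] (root : W) :
    Matrix {w : W // w ≠ root} {w : W // w ≠ root} ℝ :=
  of fun u w => if T.Adj u w then 1 else 0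

/-- The projection onto the vertices other than the root which have degree `d` in `T`. -/
def branchProj {W : Type*} [Fintype W] [DecidableEq W] (T : SimpleGraph W)
    [DecidableRel T.Adj] (root : W) (d : ℕ) :
    Matrix {w : W // w ≠ root} {w : W // w ≠ root} ℝ :=
  diagonal fun w => if T.degree w = d then 1 else 0

/-- The projection onto the vertices of `S` which have degree `d` once `k` further edges are
attached at `r`. -/
def stemProj {V : Type*} [Fintype V] [DecidableEq V] (S : SimpleGraph V) [DecidableRel S.Adj]
    (r : V) (k d : ℕ) : Matrix V V ℝ :=
  diagonal fun v => if S.degree v + (if v = r then k else 0) = d then 1 else 0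

theorem adjMatrix_coalescence {V W : Type*} [Fintype V] [DecidableEq V] [Fintype W]
    [DecidableEq W] (S : SimpleGraph V) [DecidableRel S.Adj] (r : V) (T : SimpleGraph W)
    [DecidableRel T.Adj] (root : W) :
    (coalescence S r T root).adjMatrix ℝ =
      fromBlocks (S.adjMatrix ℝ) (rootBlock r T root) (rootBlock r T root)ᵀ
        (branchAdj T root) := by
  ext (i | i) (j | j)
  · rfl
  · rfl
  · rw [fromBlocks_apply₂₁, transpose_apply, SimpleGraph.adjMatrix_apply]
    change (if j = r ∧ T.Adj i root then (1 : ℝ) else 0) = if j = r ∧ T.Adj root i then 1 else 0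
    exact if_congr (by rw [T.adj_comm]) rfl rfl
  · rfl

theorem degProj_coalescence {V W : Type*} [Fintype V] [DecidableEq V] [Fintype W]
    [DecidableEq W] (S : SimpleGraph V) [DecidableRel S.Adj] (r : V) (T : SimpleGraph W)
    [DecidableRel T.Adj] (root : W) (d : ℕ) :
    degProj (coalescence S r T root) d =
      fromBlocks (stemProj S r (T.degree root) d) 0 0 (branchProj T root d) := by
  rw [degProj, stemProj, branchProj, fromBlocks_diagonal]
  congr 1
  ext (v | w)
  · rw [degree_coalescence_inl, Sum.elim_inl]
  · rw [degree_coalescence_inr, Sum.elim_inr]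

/-- Away from the degree of `r` in the coalescence, the projection kills the joining block. -/
theorem stemProj_mul_rootBlock {V W : Type*} [Fintype V] [DecidableEq V]
    (S : SimpleGraph V) [DecidableRel S.Adj] (r : V) (T : SimpleGraph W)
    [DecidableRel T.Adj] (root : W) {k d : ℕ} (hd : S.degree r + k ≠ d) :
    stemProj S r k d * rootBlock r T root = 0 := by
  ext v w
  rw [stemProj, diagonal_mul]
  rcases eq_or_ne v r with rfl | hv
  · simp [hd]
  · simp [rootBlock, hv]

theorem rootBlock_transpose_mul_stemProj {V W : Type*} [Fintype V] [DecidableEq V]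
    (S : SimpleGraph V) [DecidableRel S.Adj] (r : V) (T : SimpleGraph W)
    [DecidableRel T.Adj] (root : W) {k d : ℕ} (hd : S.degree r + k ≠ d) :
    (rootBlock r T root)ᵀ * stemProj S r k d = 0 := by
  have := congrArg transpose (stemProj_mul_rootBlock S r T root hd)
  simpa [transpose_mul, stemProj] using this

/-! ### Closed walks into a pendant path of a coalescence -/

/-- A step between vertices whose degrees differ from that of `r` cannot pass from one part of the
coalescence to the other, so it preserves block diagonal matrices. -/
theorem degProj_mul_adjMatrix_mul_fromBlocks {V W : Type*} [Fintype V] [DecidableEq V] [Fintype W]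
    [DecidableEq W] (S : SimpleGraph V) [DecidableRel S.Adj] (r : V) (T : SimpleGraph W)
    [DecidableRel T.Adj] (root : W) {c d : ℕ} (hc : S.degree r + T.degree root ≠ c)
    (hd : S.degree r + T.degree root ≠ d) (Y : Matrix V V ℝ)
    (Z : Matrix {w : W // w ≠ root} {w : W // w ≠ root} ℝ) :
    degProj (coalescence S r T root) c * (coalescence S r T root).adjMatrix ℝ *
        fromBlocks (stemProj S r (T.degree root) d * Y) 0 0 Z =
      fromBlocks (stemProj S r (T.degree root) c *
          (S.adjMatrix ℝ * (stemProj S r (T.degree root) d * Y))) 0 0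
        (branchProj T root c * (branchAdj T root * Z)) := by
  rw [degProj_coalescence, adjMatrix_coalescence, fromBlocks_multiply, fromBlocks_multiply]
  simp only [Matrix.zero_mul, Matrix.mul_zero, add_zero, zero_add]
  rw [stemProj_mul_rootBlock S r T root hc, Matrix.mul_assoc (branchProj T root c),
    ← Matrix.mul_assoc (rootBlock r T root)ᵀ, rootBlock_transpose_mul_stemProj S r T root hd]
  simp [Matrix.mul_assoc]

/-- The contribution of the walks inside `S` to `E₂ A E₂ A E₁ A E₂ A E₂`, when `k` further edges
are attached at `r`. -/
def stemLeg {V : Type*} [Fintype V] [DecidableEq V] (S : SimpleGraph V) [DecidableRel S.Adj]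
    (r : V) (k : ℕ) : Matrix V V ℝ :=
  stemProj S r k 2 * (S.adjMatrix ℝ * (stemProj S r k 2 * (S.adjMatrix ℝ * (stemProj S r k 1 *
    (S.adjMatrix ℝ * (stemProj S r k 2 * (S.adjMatrix ℝ * stemProj S r k 2)))))))

theorem branchProj_mul_self {W : Type*} [Fintype W] [DecidableEq W] (T : SimpleGraph W)
    [DecidableRel T.Adj] (root : W) (d : ℕ) :
    branchProj T root d * branchProj T root d = branchProj T root d := by
  rw [branchProj, diagonal_mul_diagonal]
  congr 1
  ext w
  split_ifs <;> simp

theorem branchProj_transpose {W : Type*} [Fintype W] [DecidableEq W] (T : SimpleGraph W)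
    [DecidableRel T.Adj] (root : W) (d : ℕ) : (branchProj T root d)ᵀ = branchProj T root d :=
  diagonal_transpose _

theorem branchAdj_transpose {W : Type*} (T : SimpleGraph W) [DecidableRel T.Adj] (root : W) :
    (branchAdj T root)ᵀ = branchAdj T root := by
  ext u w
  exact if_congr (by rw [T.adj_comm]) rfl rfl

/-- If `T` minus its root has exactly one path `h, m, e` along which the degrees are `2, 2, 1`, then
the only closed walk through vertices of degrees `2, 2, 1, 2, 2` goes from `h` to `e` and back. -/
theorem branch_leg {W : Type*} [Fintype W] [DecidableEq W] (T : SimpleGraph W)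
    [DecidableRel T.Adj] (root : W) {h m e : {w : W // w ≠ root}}
    (hleg : ∀ i b l : {w : W // w ≠ root}, (T.degree i = 2 ∧ T.Adj i b ∧ T.degree b = 2 ∧
      T.Adj b l ∧ T.degree l = 1) ↔ (i = h ∧ b = m ∧ l = e)) :
    branchProj T root 2 * (branchAdj T root * (branchProj T root 2 * (branchAdj T root *
      (branchProj T root 1 * (branchAdj T root * (branchProj T root 2 * (branchAdj T root *
        branchProj T root 2))))))) = single h h 1 := by
  -- The walk is cut at its middle vertex, a leaf: both halves count paths from `h` to `e`.
  have hK : branchProj T root 2 * (branchAdj T root * (branchProj T root 2 * (branchAdj T root *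
      branchProj T root 1))) = single h e 1 := by
    ext i l
    have h1 : ∀ b, (if T.degree i = 2 then 1 else 0) * (branchAdj T root i b *
        ((if T.degree b = 2 then 1 else 0) * (branchAdj T root b l *
          (if T.degree l = 1 then 1 else 0)))) = if b = m then single h e (1 : ℝ) i l else 0 := by
      intro b
      have h2 : (if T.degree i = 2 then 1 else 0) * (branchAdj T root i b *
          ((if T.degree b = 2 then 1 else 0) * (branchAdj T root b l *
          (if T.degree l = 1 then 1 else 0)))) = if (T.degree i = 2 ∧ T.Adj i b ∧ T.degree b = 2 ∧
          T.Adj b l ∧ T.degree l = 1) then (1 : ℝ) else 0 := by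
        simp only [branchAdj, of_apply, ← ite_and, mul_ite, mul_one, mul_zero]
        exact if_congr (by tauto) rfl rfl
      rw [h2, if_congr (hleg i b l) rfl rfl, single_apply, ← ite_and]
      exact if_congr ⟨fun ⟨p, q, s⟩ => ⟨q, p.symm, s.symm⟩, fun ⟨q, p, s⟩ => ⟨p.symm, q, s.symm⟩⟩
        rfl rfl
    rw [branchProj, diagonal_mul, mul_apply, Finset.mul_sum]
    simp only [branchProj, diagonal_mul, mul_diagonal]
    rw [Finset.sum_congr rfl fun b _ => h1 b]
    simp
  have hK' := congrArg transpose hK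
  simp only [transpose_mul, branchProj_transpose, branchAdj_transpose, transpose_single] at hK'
  calc _ = (branchProj T root 2 * (branchAdj T root * (branchProj T root 2 * (branchAdj T root *
      branchProj T root 1)))) * (branchProj T root 1 * branchAdj T root * branchProj T root 2 *
        branchAdj T root * branchProj T root 2) := by
        simp only [Matrix.mul_assoc]
        rw [← Matrix.mul_assoc (branchProj T root 1) (branchProj T root 1), branchProj_mul_self]
    _ = single h e 1 * single e h 1 := by
      rw [hK, ← hK']
    _ = _ := by simp

/-- Extending the closed walk based at `h` by a step at both ends to a vertex of degree `3`, when
`v` is the only such neighbour of `h`. -/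
theorem branch_fork {W : Type*} [Fintype W] [DecidableEq W] (T : SimpleGraph W)
    [DecidableRel T.Adj] (root : W) {h v : {w : W // w ≠ root}}
    (hv : ∀ w : {w : W // w ≠ root}, (T.degree w = 3 ∧ T.Adj w h) ↔ w = v) :
    branchProj T root 3 * (branchAdj T root * (single h h 1 * (branchAdj T root *
      branchProj T root 3))) = single v v 1 := by
  have hK : branchProj T root 3 * (branchAdj T root * single h h 1) = single v h 1 := by
    ext i l
    rw [branchProj, diagonal_mul]
    rcases eq_or_ne l h with rfl | hl
    · rw [mul_single_apply_same, branchAdj, of_apply, single_apply, mul_one, mul_ite, mul_one,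
        mul_zero, ← ite_and]
      refine if_congr ?_ rfl rfl
      rw [and_comm, hv]
      tauto
    · rw [mul_single_apply_of_ne _ _ _ _ _ hl, single_apply_of_col_ne]
      · simp
      · exact hl.symm
  have hK' := congrArg transpose hK
  simp only [transpose_mul, branchProj_transpose, branchAdj_transpose, transpose_single] at hK'
  calc _ = (branchProj T root 3 * (branchAdj T root * single h h 1)) *
        (single h h 1 * branchAdj T root * branchProj T root 3) := by
        simp only [Matrix.mul_assoc]
        rw [← Matrix.mul_assoc (single h h 1) (single h h 1)]
        simp
    _ = single v h 1 * single h v 1 := by rw [hK, hK']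
    _ = _ := by simp

/-- Walks through vertices of degrees `2, 2, 1, 2, 2` avoid `r`, whose degree is at least `3`; hence
they stay in one part of the coalescence. -/
theorem degProj_leg_coalescence {V W : Type*} [Fintype V] [DecidableEq V] [Fintype W]
    [DecidableEq W] (S : SimpleGraph V) [DecidableRel S.Adj] (r : V) (T : SimpleGraph W)
    [DecidableRel T.Adj] (root : W) {h m e : {w : W // w ≠ root}}
    (hdeg : 3 ≤ S.degree r + T.degree root)
    (hleg : ∀ i b l : {w : W // w ≠ root}, (T.degree i = 2 ∧ T.Adj i b ∧ T.degree b = 2 ∧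
      T.Adj b l ∧ T.degree l = 1) ↔ (i = h ∧ b = m ∧ l = e))
    {A : Matrix (V ⊕ {w : W // w ≠ root}) (V ⊕ {w : W // w ≠ root}) ℝ}
    {E : ℕ → Matrix (V ⊕ {w : W // w ≠ root}) (V ⊕ {w : W // w ≠ root}) ℝ}
    (hA : A = (coalescence S r T root).adjMatrix ℝ) (hE : E = degProj (coalescence S r T root)) :
    E 2 * (A * (E 2 * (A * (E 1 * (A * (E 2 * (A * E 2))))))) =
      fromBlocks (stemLeg S r (T.degree root)) 0 0 (single h h 1) := by
  have h2 : S.degree r + T.degree root ≠ 2 := by omega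
  have h1 : S.degree r + T.degree root ≠ 1 := by omega
  have key {c d : ℕ} (hc : S.degree r + T.degree root ≠ c) (hd : S.degree r + T.degree root ≠ d)
      (Y : Matrix V V ℝ) (Z : Matrix {w : W // w ≠ root} {w : W // w ≠ root} ℝ) :
      E c * (A * fromBlocks (stemProj S r (T.degree root) d * Y) 0 0 Z) =
        fromBlocks (stemProj S r (T.degree root) c *
          (S.adjMatrix ℝ * (stemProj S r (T.degree root) d * Y))) 0 0
        (branchProj T root c * (branchAdj T root * Z)) := by
    rw [hE, hA, ← Matrix.mul_assoc, degProj_mul_adjMatrix_mul_fromBlocks S r T root hc hd]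
  have h0 : E 2 = fromBlocks (stemProj S r (T.degree root) 2 * 1) 0 0 (branchProj T root 2) := by
    rw [hE, degProj_coalescence, Matrix.mul_one]
  have h22 := key h2 h2 1 (branchProj T root 2)
  rw [← h0] at h22
  rw [h22, key h1 h2, key h2 h1, key h2 h2, branch_leg T root hleg, Matrix.mul_one, stemLeg]

/-- The number of closed walks whose degrees are `d, 3, 2, 2, 1, 2, 2, 3`, where `d` is the degree of
`r` in the coalescence. Such a walk goes from a vertex `u` of degree `d` to a vertex of degree `3` and
into a pendant path there, and back. The four terms count the walks inside `S`, those with `u = r`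
whose pendant path lies in `T`, those with `u` in `T` whose pendant path lies in `S`, and those that
avoid `S`. Apart from the degree of the root, the tree `T` enters only through the last three. -/
theorem trace_walkMatrix_coalescence {V W : Type*} [Fintype V] [DecidableEq V] [Fintype W]
    [DecidableEq W] (S : SimpleGraph V) [DecidableRel S.Adj] (r : V) (T : SimpleGraph W)
    [DecidableRel T.Adj] (root : W) {h m e v : {w : W // w ≠ root}}
    (hdeg : 3 ≤ S.degree r + T.degree root)
    (hleg : ∀ i b l : {w : W // w ≠ root}, (T.degree i = 2 ∧ T.Adj i b ∧ T.degree b = 2 ∧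
      T.Adj b l ∧ T.degree l = 1) ↔ (i = h ∧ b = m ∧ l = e))
    (hh : ¬ T.Adj root h)
    (hv : ∀ w : {w : W // w ≠ root}, (T.degree w = 3 ∧ T.Adj w h) ↔ w = v) :
    (walkMatrix (coalescence S r T root) [S.degree r + T.degree root, 3, 2, 2, 1, 2, 2, 3]).trace =
      (stemProj S r (T.degree root) (S.degree r + T.degree root) * (S.adjMatrix ℝ *
        ((stemProj S r (T.degree root) 3 * (S.adjMatrix ℝ * (stemLeg S r (T.degree root) *
          (S.adjMatrix ℝ * stemProj S r (T.degree root) 3)))) * S.adjMatrix ℝ))).trace +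
      (if T.Adj root v then 1 else 0) +
      (stemProj S r (T.degree root) 3 * (S.adjMatrix ℝ * (stemLeg S r (T.degree root) *
          (S.adjMatrix ℝ * stemProj S r (T.degree root) 3)))) r r *
        (∑ w : {w : W // w ≠ root},
          if T.Adj root w ∧ T.degree w = S.degree r + T.degree root then 1 else 0) +
      ∑ w : {w : W // w ≠ root},
        if T.Adj w v ∧ T.degree w = S.degree r + T.degree root then 1 else 0 := by
  have h2 : S.degree r + T.degree root ≠ 2 := by omega
  have hH := degProj_leg_coalescence S r T root hdeg hleg rfl rfl
  generalize hL : stemLeg S r (T.degree root) = L at hH ⊢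
  have hCL : (rootBlock r T root)ᵀ * L = 0 := by
    rw [← hL, stemLeg, ← Matrix.mul_assoc, rootBlock_transpose_mul_stemProj S r T root h2,
      Matrix.zero_mul]
  have hLC : L * rootBlock r T root = 0 := by
    rw [← hL, stemLeg]
    simp only [Matrix.mul_assoc]
    rw [stemProj_mul_rootBlock S r T root h2]
    simp only [Matrix.mul_zero]
  have hCh : rootBlock r T root * single h h (1 : ℝ) = 0 := by
    ext i j
    rcases eq_or_ne j h with rfl | hj
    · simp [rootBlock, hh]
    · simp [hj]
  have hhC : single h h (1 : ℝ) * (rootBlock r T root)ᵀ = 0 := by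
    simpa using congrArg transpose hCh
  have hΛ : degProj (coalescence S r T root) 3 * ((coalescence S r T root).adjMatrix ℝ *
      (fromBlocks L 0 0 (single h h 1) * ((coalescence S r T root).adjMatrix ℝ *
        degProj (coalescence S r T root) 3))) =
      fromBlocks (stemProj S r (T.degree root) 3 * (S.adjMatrix ℝ * (L *
          (S.adjMatrix ℝ * stemProj S r (T.degree root) 3)))) 0 0 (single v v 1) := by
    rw [degProj_coalescence, adjMatrix_coalescence]
    simp only [fromBlocks_multiply, Matrix.zero_mul, Matrix.mul_zero, add_zero, zero_add]
    have e1 (Y : Matrix V V ℝ) : (rootBlock r T root)ᵀ * (L * Y) = 0 := by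
      rw [← Matrix.mul_assoc, hCL, Matrix.zero_mul]
    have e2 (Y : Matrix {w : W // w ≠ root} {w : W // w ≠ root} ℝ) :
        L * (rootBlock r T root * Y) = 0 := by
      rw [← Matrix.mul_assoc, hLC, Matrix.zero_mul]
    have e3 (Y : Matrix {w : W // w ≠ root} {w : W // w ≠ root} ℝ) :
        rootBlock r T root * (single h h (1 : ℝ) * Y) = 0 := by
      rw [← Matrix.mul_assoc, hCh, Matrix.zero_mul]
    have e4 (Y : Matrix V V ℝ) : single h h (1 : ℝ) * ((rootBlock r T root)ᵀ * Y) = 0 := by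
      rw [← Matrix.mul_assoc, hhC, Matrix.zero_mul]
    rw [← branch_fork T root hv]
    simp only [e1, e2, e3, e4, Matrix.mul_zero, add_zero, zero_add]
  generalize hd : S.degree r + T.degree root = d
  have hW : walkMatrix (coalescence S r T root) [d, 3, 2, 2, 1, 2, 2, 3] =
      degProj (coalescence S r T root) d * ((coalescence S r T root).adjMatrix ℝ *
        ((degProj (coalescence S r T root) 3 * ((coalescence S r T root).adjMatrix ℝ *
      (fromBlocks L 0 0 (single h h 1) * ((coalescence S r T root).adjMatrix ℝ *
        degProj (coalescence S r T root) 3)))) * (coalescence S r T root).adjMatrix ℝ)) := by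
    rw [← hH]
    simp only [walkMatrix, Matrix.mul_one, Matrix.mul_assoc]
  rw [hW, hΛ]
  generalize hM : stemProj S r (T.degree root) 3 * (S.adjMatrix ℝ * (L *
          (S.adjMatrix ℝ * stemProj S r (T.degree root) 3))) = M
  rw [degProj_coalescence, adjMatrix_coalescence]
  simp only [fromBlocks_multiply, Matrix.zero_mul, add_zero, zero_add, Matrix.mul_add]
  rw [trace, Fintype.sum_sum_type]
  simp only [diag_apply, fromBlocks_apply₁₁, fromBlocks_apply₂₂]
  change trace (_ + _) + trace (_ + _) = _
  rw [trace_add, trace_add]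
  have t1 : (stemProj S r (T.degree root) d * (rootBlock r T root * (single v v (1 : ℝ) *
      (rootBlock r T root)ᵀ))).trace = if T.Adj root v then 1 else 0 := by
    rw [← Matrix.mul_assoc, trace_mul_comm, Matrix.mul_assoc, trace_single_mul, ← Matrix.mul_assoc,
      mul_apply, Finset.sum_eq_single r]
    · simp [rootBlock, stemProj, hd]
    · intro b _ hb
      simp [rootBlock, hb]
    · simp
  have t2 : (branchProj T root d * ((rootBlock r T root)ᵀ * (M * rootBlock r T root))).trace =
      M r r * ∑ w : {w : W // w ≠ root}, if T.Adj root w ∧ T.degree w = d then 1 else 0 := by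
    rw [trace, Finset.mul_sum]
    refine Finset.sum_congr rfl fun w _ => ?_
    have h3 : ((rootBlock r T root)ᵀ * (M * rootBlock r T root)) w w =
        if T.Adj root w then M r r else 0 := by
      rw [mul_apply, Finset.sum_eq_single r]
      · rw [mul_apply, Finset.sum_eq_single r]
        · by_cases h4 : T.Adj root w <;> simp [rootBlock, h4]
        · intro b _ hb
          simp [rootBlock, hb]
        · simp
      · intro b _ hb
        simp [rootBlock, hb]
      · simp
    rw [diag_apply, branchProj, diagonal_mul, h3]
    by_cases h4 : T.Adj root w <;> by_cases h5 : T.degree w = d <;> simp [h4, h5]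
  have t3 : (branchProj T root d * (branchAdj T root * (single v v (1 : ℝ) * branchAdj T root))).trace =
      ∑ w : {w : W // w ≠ root}, if T.Adj w v ∧ T.degree w = d then 1 else 0 := by
    rw [trace]
    refine Finset.sum_congr rfl fun w _ => ?_
    rw [diag_apply, branchProj, diagonal_mul, mul_apply, Finset.sum_eq_single v]
    · by_cases h4 : T.Adj w v <;> by_cases h5 : T.degree w = d <;>
        simp [branchAdj, h4, h5, T.adj_comm v w]
    · intro b _ hb
      simp [hb]
    · simp
  rw [t1, t2, t3]
  ring

/-! ### The count distinguishing the two trees -/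

/-- In `treeTwo` the neighbour `5` of the root has degree `3` and carries the pendant path `6, 7, 8`,
whereas in `treeOne` the only such pendant path, `8, 9, 10`, hangs at `7`, which is not adjacent to
the root. All other contributions to the number of closed walks agree. -/
theorem not_degreeSimilar_coalescence_treeOne_treeTwo {V : Type*} [Fintype V] [DecidableEq V]
    (S : SimpleGraph V) [DecidableRel S.Adj] (r : V) (hr : 0 < S.degree r) :
    ¬ DegreeSimilar (coalescence S r treeOne 0) (coalescence S r treeTwo 0) := by
  intro hsim
  have hd₁ : treeOne.degree 0 = 2 := degree_treeOne 0
  have hd₂ : treeTwo.degree 0 = 2 := degree_treeTwo 0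
  have htr := hsim.trace_walkMatrix_eq [S.degree r + 2, 3, 2, 2, 1, 2, 2, 3]
  have w₁ := trace_walkMatrix_coalescence S r treeOne 0
    (h := ⟨8, by decide⟩) (m := ⟨9, by decide⟩) (e := ⟨10, by decide⟩) (v := ⟨7, by decide⟩)
    (by omega) (by simp only [degree_treeOne]; decide +kernel) (by decide)
    (by simp only [degree_treeOne]; decide)
  have w₂ := trace_walkMatrix_coalescence S r treeTwo 0
    (h := ⟨6, by decide⟩) (m := ⟨7, by decide⟩) (e := ⟨8, by decide⟩) (v := ⟨5, by decide⟩)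
    (by omega) (by simp only [degree_treeTwo]; decide +kernel) (by decide)
    (by simp only [degree_treeTwo]; decide)
  rw [hd₁] at w₁
  rw [hd₂] at w₂
  rw [w₁, w₂, if_neg (by decide), if_pos (by decide)] at htr
  -- Both roots have one child of degree `3` and one of degree `2`, and only the former can have the
  -- same degree as `r` in the coalescence, namely when `r` is a leaf of `S`.
  have s₁ : (∑ w : {w : Fin 16 // w ≠ 0},
      if treeOne.Adj 0 w ∧ treeOne.degree w = S.degree r + 2 then (1 : ℝ) else 0) =
      if S.degree r = 1 then 1 else 0 := by
    have h : ∀ w : {w : Fin 16 // w ≠ 0}, w ≠ ⟨1, by decide⟩ →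
        ¬(treeOne.Adj 0 w ∧ 3 ≤ treeOne.degree w) := by
      simp only [degree_treeOne]; decide
    rw [Finset.sum_eq_single (⟨1, by decide⟩ : {w : Fin 16 // w ≠ 0})
      (fun w _ hw => if_neg fun hw' => h w hw ⟨hw'.1, by omega⟩) (by simp)]
    have h1 : treeOne.Adj 0 1 := by decide
    have h2 : treeOne.degree 1 = 3 := degree_treeOne 1
    exact if_congr (by simp only [h1, h2, true_and]; omega) rfl rfl
  have s₂ : (∑ w : {w : Fin 16 // w ≠ 0},
      if treeTwo.Adj 0 w ∧ treeTwo.degree w = S.degree r + 2 then (1 : ℝ) else 0) =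
      if S.degree r = 1 then 1 else 0 := by
    have h : ∀ w : {w : Fin 16 // w ≠ 0}, w ≠ ⟨5, by decide⟩ →
        ¬(treeTwo.Adj 0 w ∧ 3 ≤ treeTwo.degree w) := by
      simp only [degree_treeTwo]; decide
    rw [Finset.sum_eq_single (⟨5, by decide⟩ : {w : Fin 16 // w ≠ 0})
      (fun w _ hw => if_neg fun hw' => h w hw ⟨hw'.1, by omega⟩) (by simp)]
    have h1 : treeTwo.Adj 0 5 := by decide
    have h2 : treeTwo.degree 5 = 3 := degree_treeTwo 5
    exact if_congr (by simp only [h1, h2, true_and]; omega) rfl rfl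
  -- The neighbours of `7` in `treeOne`, and those of `5` in `treeTwo` other than the root, have
  -- degree `2`, less than that of `r`.
  have z₁ : (∑ w : {w : Fin 16 // w ≠ 0},
      if treeOne.Adj w 7 ∧ treeOne.degree w = S.degree r + 2 then (1 : ℝ) else 0) = 0 := by
    have h : ∀ w : {w : Fin 16 // w ≠ 0}, ¬(treeOne.Adj w 7 ∧ 3 ≤ treeOne.degree w) := by
      simp only [degree_treeOne]; decide
    exact Finset.sum_eq_zero fun w _ => if_neg fun hw => h w ⟨hw.1, by omega⟩
  have z₂ : (∑ w : {w : Fin 16 // w ≠ 0},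
      if treeTwo.Adj w 5 ∧ treeTwo.degree w = S.degree r + 2 then (1 : ℝ) else 0) = 0 := by
    have h : ∀ w : {w : Fin 16 // w ≠ 0}, ¬(treeTwo.Adj w 5 ∧ 3 ≤ treeTwo.degree w) := by
      simp only [degree_treeTwo]; decide
    exact Finset.sum_eq_zero fun w _ => if_neg fun hw => h w ⟨hw.1, by omega⟩
  rw [s₁, s₂, z₁, z₂] at htr
  linarith

theorem mainTheorem1 {V : Type*} [Fintype V] [DecidableEq V] [Nontrivial V]
    (S : SimpleGraph V) [DecidableRel S.Adj] (hS : S.IsTree) (r : V) :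
    psi (coalescence S r treeOne 0) = psi (coalescence S r treeTwo 0) ∧
      ¬ DegreeSimilar (coalescence S r treeOne 0) (coalescence S r treeTwo 0) :=
  ⟨psi_coalescence_treeOne_eq_treeTwo S r,
    not_degreeSimilar_coalescence_treeOne_treeTwo S r
      (hS.connected.preconnected.degree_pos_of_nontrivial r)⟩
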